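/- All Hilbert spaces are non-zero and finite-dimensional with fixed orthonormal bases; $\mathbb 1$ denotes an identity operator, $T$ the transpose in these bases, and $J_{\mathcal F}=\sum_{i,j}|i\rangle\langle j|\otimes\mathcal F(|i\rangle\langle j|)$ the Choi–Jamiołkowski matrix of a linear map $\mathcal F$. A quantum channel is a completely positive trace-preserving linear map. Let $\mathcal N_{A_o\to B_i}$ and $\mathcal M_{A_i\to B_o}$ be quantum channels. A no-signalling (NS) code is a quantum channel $\Pi$ from $A_iB_i$ to $A_oB_o$ such that $\operatorname{tr}_{A_o}\Pi(\rho_1\otimes\sigma)=\operatorname{tr}_{A_o}\Pi(\rho_2\otimes\sigma)$ for all states $\rho_1,\rho_2$ on $A_i$ and operators $\sigma$ on $B_i$, and $\operatorname{tr}_{B_o}\Pi(\sigma\otimes\rho_1)=\operatorname{tr}_{B_o}\Pi(\sigma\otimes\rho_2)$ for all states $\rho_1,\rho_2$ on $B_i$ and operators $\sigma$ on $A_i$. A code $\Pi$ is PPT if $J_\Pi^{T_{B_iB_o}}\ge 0$, where $T_{B_iB_o}$ is the partial transpose over $B_iB_o$. Let $\Pi\circ\mathcal N$ be the map from $A_i$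 to $B_o$ obtained by sending the output $A_o$ of $\Pi$ through $\mathcal N$ into the input $B_i$ of $\Pi$, that is, $$(\Pi\circ\mathcal N)(X)=\sum_{k,l}(\langle k|_{B_i}\otimes\mathbb 1_{B_o})\,(\mathcal N\otimes\mathrm{id}_{B_o})\big(\Pi(X\otimes|k\rangle\langle l|_{B_i})\big)\,(|l\rangle_{B_i}\otimes\mathbb 1_{B_o}).$$ For a class $\Omega$ of codes let $$\omega_\Omega(\mathcal N,\mathcal M)=\tfrac12\inf_{\Pi\in\Omega}\|\Pi\circ\mathcal N-\mathcal M\|_\diamondsuit,\qquad \|\mathcal F\|_\diamondsuit=\sup_{k\in\mathbb N}\ \sup_{\|X\|_1\le1}\|(\mathcal F\otimes\mathrm{id}_k)(X)\|_1,\qquad \|X\|_1=\operatorname{tr}\sqrt{X^\dagger X}.$$ Then $\omega_{\rm NS}(\mathcal N,\mathcal M)$ equals the value of the semidefinite program $$\begin{aligned}\inf\quad&\gamma\\ \text{s.t.}\quad&\operatorname{tr}_{B_o}Y_{A_iB_o}\le\gamma\,\mathbb 1_{A_i},\\ &Y_{A_iB_o}\ge J_{\widetilde{\mathcal M}}-J_{\mathcal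 M},\quad Y_{A_iB_o}\ge0,\\ &J_{\widetilde{\mathcal M}}=\operatorname{tr}_{A_oB_i}\big[(J_{\mathcal N}^T\otimes\mathbb 1_{A_iB_o})J_\Pi\big],\\ &J_\Pi\ge0,\quad\operatorname{tr}_{A_oB_o}J_\Pi=\mathbb 1_{A_iB_i},\\ &\operatorname{tr}_{A_o}J_\Pi=\tfrac{\mathbb 1_{A_i}}{|A_i|}\otimes\operatorname{tr}_{A_oA_i}J_\Pi,\\ &\operatorname{tr}_{B_o}J_\Pi=\tfrac{\mathbb 1_{B_i}}{|B_i|}\otimes\operatorname{tr}_{B_iB_o}J_\Pi,\end{aligned}$$ where the infimum is over real $\gamma$ and over operators $Y_{A_iB_o}$, $J_{\widetilde{\mathcal M}}$ on $A_iB_o$ and $J_\Pi$ on $A_iB_iA_oB_o$. Moreover, $\omega_{\rm NS\cap PPT}(\mathcal N,\mathcal M)$, where $\Omega$ is the class of codes that are both NS and PPT, equals the value of the same program with the additional constraint $J_\Pi^{T_{B_iB_o}}\ge0$. -/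

import Mathlib

open scoped Kronecker MatrixOrder ComplexOrder

namespace ChannelSim

noncomputable section

/- A system is a finite index type `n` (an orthonormal basis of its Hilbert space); operators on it
are the matrices `Matrix n n ℂ`. The tensor product of systems is the product of index types, and
`≤` between operators is the Loewner order. -/

/-- Partial trace over the first tensor factor. -/
def traceLeft {m n : Type*} [Fintype m] (X : Matrix (m × n) (m × n) ℂ) : Matrix n n ℂ :=
  Matrix.of fun p q => ∑ i, X (i, p) (i, q)

/-- Partial trace over the second tensor factor. -/
def traceRight {m n : Type*} [Fintype n] (X : Matrix (m × n) (m × n) ℂ) : Matrix m m ℂ :=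
  Matrix.of fun p q => ∑ i, X (p, i) (q, i)

/-- The map `F ⊗ id_κ` on operators. -/
def ampliate {m n : Type*} (F : Matrix m m ℂ →ₗ[ℂ] Matrix n n ℂ) (κ : Type*) :
    Matrix (m × κ) (m × κ) ℂ →ₗ[ℂ] Matrix (n × κ) (n × κ) ℂ where
  toFun X := Matrix.of fun x y => F (Matrix.of fun i j => X (i, x.2) (j, y.2)) x.1 y.1
  map_add' X Y := by
    ext x y
    exact congrFun (congrFun (F.map_add (Matrix.of fun i j => X (i, x.2) (j, y.2))
      (Matrix.of fun i j => Y (i, x.2) (j, y.2))) x.1) y.1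
  map_smul' c X := by
    ext x y
    exact congrFun (congrFun (F.map_smul c (Matrix.of fun i j => X (i, x.2) (j, y.2))) x.1) y.1

/-- `F ⊗ id_κ` acts as expected on product operators. -/
theorem ampliate_kronecker {m n κ : Type*} (F : Matrix m m ℂ →ₗ[ℂ] Matrix n n ℂ)
    (X : Matrix m m ℂ) (Z : Matrix κ κ ℂ) : ampliate F κ (X ⊗ₖ Z) = F X ⊗ₖ Z := by
  ext x y
  have h : (Matrix.of fun i j => (X ⊗ₖ Z) (i, x.2) (j, y.2)) = Z x.2 y.2 • X := by
    ext i j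
    simp [mul_comm]
  simp only [ampliate, LinearMap.coe_mk, AddHom.coe_mk, Matrix.of_apply]
  rw [h]
  simp [mul_comm]

/-- Complete positivity: `F ⊗ id_k` preserves positivity for all `k`. -/
def IsCP {m n : Type*} (F : Matrix m m ℂ →ₗ[ℂ] Matrix n n ℂ) : Prop :=
  ∀ (k : ℕ) (X : Matrix (m × Fin k) (m × Fin k) ℂ), 0 ≤ X → 0 ≤ ampliate F (Fin k) X

/-- Trace preservation. -/
def IsTP {m n : Type*} [Fintype m] [Fintype n] (F : Matrix m m ℂ →ₗ[ℂ] Matrix n n ℂ) : Prop :=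
  ∀ X, (F X).trace = X.trace

/-- Quantum channels: completely positive trace-preserving linear maps. -/
def IsChannel {m n : Type*} [Fintype m] [Fintype n]
    (F : Matrix m m ℂ →ₗ[ℂ] Matrix n n ℂ) : Prop :=
  IsCP F ∧ IsTP F

/-- Quantum states: positive semidefinite operators of trace one. -/
def IsState {n : Type*} [Fintype n] (ρ : Matrix n n ℂ) : Prop :=
  0 ≤ ρ ∧ ρ.trace = 1

/-- The Choi-Jamiolkowski matrix `∑ i j, |i⟩⟨j| ⊗ F (|i⟩⟨j|)`. -/
def choi {m n : Type*} [Fintype m] [DecidableEq m]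
    (F : Matrix m m ℂ →ₗ[ℂ] Matrix n n ℂ) : Matrix (m × n) (m × n) ℂ :=
  ∑ i, ∑ j, Matrix.single i j 1 ⊗ₖ F (Matrix.single i j 1)

/-- The Schatten `1`-norm `tr √(Xᴴ X)`. -/
def traceNorm {n : Type*} [Fintype n] [DecidableEq n] (X : Matrix n n ℂ) : ℝ :=
  (CFC.sqrt (X.conjTranspose * X)).trace.re

/-- The diamond norm, as a supremum of extended reals. -/
def diamondNorm {m n : Type*} [Fintype m] [DecidableEq m] [Fintype n] [DecidableEq n]
    (F : Matrix m m ℂ →ₗ[ℂ] Matrix n n ℂ) : EReal :=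
  ⨆ (k : ℕ) (X : Matrix (m × Fin k) (m × Fin k) ℂ) (_ : traceNorm X ≤ 1),
    (traceNorm (ampliate F (Fin k) X) : EReal)

section Codes

variable {Ai Ao Bi Bo : Type*}

/-- `A` cannot signal to `B`: for fixed input at `B`, the output at `B` does not depend on the
state fed in at `A`. -/
def NoSignalAB [Fintype Ai] [Fintype Ao]
    (P : Matrix (Ai × Bi) (Ai × Bi) ℂ →ₗ[ℂ] Matrix (Ao × Bo) (Ao × Bo) ℂ) : Prop :=
  ∀ ρ₁ ρ₂ : Matrix Ai Ai ℂ, IsState ρ₁ → IsState ρ₂ → ∀ σ : Matrix Bi Bi ℂ,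
    traceLeft (P (ρ₁ ⊗ₖ σ)) = traceLeft (P (ρ₂ ⊗ₖ σ))

/-- `B` cannot signal to `A`. -/
def NoSignalBA [Fintype Bi] [Fintype Bo]
    (P : Matrix (Ai × Bi) (Ai × Bi) ℂ →ₗ[ℂ] Matrix (Ao × Bo) (Ao × Bo) ℂ) : Prop :=
  ∀ ρ₁ ρ₂ : Matrix Bi Bi ℂ, IsState ρ₁ → IsState ρ₂ → ∀ σ : Matrix Ai Ai ℂ,
    traceRight (P (σ ⊗ₖ ρ₁)) = traceRight (P (σ ⊗ₖ ρ₂))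

/-- No-signalling codes: bipartite channels from `Ai Bi` to `Ao Bo` that are no-signalling in both
directions. -/
def IsNSCode [Fintype Ai] [Fintype Ao] [Fintype Bi] [Fintype Bo]
    (P : Matrix (Ai × Bi) (Ai × Bi) ℂ →ₗ[ℂ] Matrix (Ao × Bo) (Ao × Bo) ℂ) : Prop :=
  IsChannel P ∧ NoSignalAB P ∧ NoSignalBA P

/-- Partial transpose over the systems `Bi` and `Bo`. -/
def partialTransposeB (J : Matrix ((Ai × Bi) × (Ao × Bo)) ((Ai × Bi) × (Ao × Bo)) ℂ) :
    Matrix ((Ai × Bi) × (Ao × Bo)) ((Ai × Bi) × (Ao × Bo)) ℂ :=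
  Matrix.of fun x y =>
    J ((x.1.1, y.1.2), (x.2.1, y.2.2)) ((y.1.1, x.1.2), (y.2.1, x.2.2))

/-- The PPT condition on a bipartite map: its Choi matrix has positive partial transpose. -/
def IsPPT [Fintype Ai] [DecidableEq Ai] [Fintype Bi] [DecidableEq Bi]
    (P : Matrix (Ai × Bi) (Ai × Bi) ℂ →ₗ[ℂ] Matrix (Ao × Bo) (Ao × Bo) ℂ) : Prop :=
  0 ≤ partialTransposeB (choi P)

/-- The composition `P ∘ N` of a bipartite map `P` from `Ai Bi` to `Ao Bo` with a map `N` from `Ao`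
to `Bi`: the output `Ao` of `P` is sent through `N` and the result is fed back into the input `Bi`
of `P`. The loop is closed by the trace of the map
`Z ↦ (N ⊗ id) (P (X ⊗ Z))` over the operators `Z` on `Bi`, expanded in matrix units. -/
def compose [Fintype Bi] [DecidableEq Bi]
    (P : Matrix (Ai × Bi) (Ai × Bi) ℂ →ₗ[ℂ] Matrix (Ao × Bo) (Ao × Bo) ℂ)
    (N : Matrix Ao Ao ℂ →ₗ[ℂ] Matrix Bi Bi ℂ) :
    Matrix Ai Ai ℂ →ₗ[ℂ] Matrix Bo Bo ℂ where
  toFun X := Matrix.of fun p q =>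
    ∑ k, ∑ l, ampliate N Bo (P (X ⊗ₖ Matrix.single k l 1)) (k, p) (l, q)
  map_add' X Y := by
    ext p q
    simp [Matrix.add_kronecker, Finset.sum_add_distrib]
  map_smul' c X := by
    ext p q
    simp [Matrix.smul_kronecker, Finset.mul_sum]

/-- `compose` is the physical composition: if `P` consists of an encoder `E` from `Ai` to `Ao R`
and a decoder `D` from `Bi R` to `Bo`, with any memory system `R`, then `compose P N` is
`D ∘ (N ⊗ id_R) ∘ E`. -/
theorem compose_of_realization {R : Type*} [Fintype Ao] [Fintype Bi] [DecidableEq Bi]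
    (P : Matrix (Ai × Bi) (Ai × Bi) ℂ →ₗ[ℂ] Matrix (Ao × Bo) (Ao × Bo) ℂ)
    (N : Matrix Ao Ao ℂ →ₗ[ℂ] Matrix Bi Bi ℂ)
    (E : Matrix Ai Ai ℂ →ₗ[ℂ] Matrix (Ao × R) (Ao × R) ℂ)
    (D : Matrix (Bi × R) (Bi × R) ℂ →ₗ[ℂ] Matrix Bo Bo ℂ)
    (hP : ∀ X Z, P (X ⊗ₖ Z) = (ampliate D Ao (Matrix.of fun x y =>
      E X (x.2, x.1.2) (y.2, y.1.2) * Z x.1.1 y.1.1)).submatrix Prod.swap Prod.swap)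
    (X : Matrix Ai Ai ℂ) : compose P N X = D (ampliate N R (E X)) := by
  classical
  have hN : ∀ (Z : Matrix Ao Ao ℂ) (k l : Bi),
      N Z k l = ∑ a, ∑ b, Z a b * N (Matrix.single a b 1) k l := by
    intro Z k l
    have h : Z = ∑ a, ∑ b, Z a b • Matrix.single a b (1 : ℂ) := by
      conv_lhs => rw [Matrix.matrix_eq_sum_single Z]
      simp
    conv_lhs => rw [h]
    simp only [map_sum, map_smul, Matrix.sum_apply, Matrix.smul_apply, smul_eq_mul]
  have hV : ampliate N R (E X) = ∑ k, ∑ l, ∑ a, ∑ b, N (Matrix.single a b 1) k l •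
      (Matrix.of fun x y : Bi × R =>
        E X (a, x.2) (b, y.2) * (Matrix.single k l (1 : ℂ) : Matrix Bi Bi ℂ) x.1 y.1) := by
    ext x y
    simp only [ampliate, LinearMap.coe_mk, AddHom.coe_mk, Matrix.of_apply, Matrix.sum_apply,
      Matrix.smul_apply, smul_eq_mul]
    rw [hN, Finset.sum_eq_single x.1, Finset.sum_eq_single y.1]
    · simp [mul_comm]
    · intro l _ hl
      simp [hl]
    · simp
    · intro k _ hk
      simp [hk]
    · simp
  rw [hV]
  ext p q
  simp only [compose, LinearMap.coe_mk, AddHom.coe_mk, Matrix.of_apply, map_sum, map_smul,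
    Matrix.sum_apply, Matrix.smul_apply, smul_eq_mul]
  refine Finset.sum_congr rfl fun k _ => Finset.sum_congr rfl fun l _ => ?_
  rw [hP]
  simp only [ampliate, LinearMap.coe_mk, AddHom.coe_mk, Matrix.of_apply]
  rw [hN]
  refine Finset.sum_congr rfl fun a _ => Finset.sum_congr rfl fun b _ => ?_
  rw [mul_comm]
  rfl

/-- `ω_Ω(N, M)`: half the infimum of the diamond-norm errors over the codes in `Ω`. -/
def simError [Fintype Ai] [DecidableEq Ai] [Fintype Bi] [DecidableEq Bi]
    [Fintype Bo] [DecidableEq Bo]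
    (Ω : Set (Matrix (Ai × Bi) (Ai × Bi) ℂ →ₗ[ℂ] Matrix (Ao × Bo) (Ao × Bo) ℂ))
    (N : Matrix Ao Ao ℂ →ₗ[ℂ] Matrix Bi Bi ℂ) (M : Matrix Ai Ai ℂ →ₗ[ℂ] Matrix Bo Bo ℂ) :
    EReal :=
  ((1 / 2 : ℝ) : EReal) * ⨅ P ∈ Ω, diamondNorm (compose P N - M)

/-- Partial trace over `Ao`. -/
def traceAo [Fintype Ao] (J : Matrix ((Ai × Bi) × (Ao × Bo)) ((Ai × Bi) × (Ao × Bo)) ℂ) :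
    Matrix (Ai × (Bi × Bo)) (Ai × (Bi × Bo)) ℂ :=
  Matrix.of fun x y => ∑ a, J ((x.1, x.2.1), (a, x.2.2)) ((y.1, y.2.1), (a, y.2.2))

/-- Partial trace over `Bo`. -/
def traceBo [Fintype Bo] (J : Matrix ((Ai × Bi) × (Ao × Bo)) ((Ai × Bi) × (Ao × Bo)) ℂ) :
    Matrix (Bi × (Ai × Ao)) (Bi × (Ai × Ao)) ℂ :=
  Matrix.of fun x y => ∑ b, J ((x.2.1, x.1), (x.2.2, b)) ((y.2.1, y.1), (y.2.2, b))

/-- The systems `Ai Bi Ao Bo` listed in the order `Ao Bi Ai Bo`. -/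
def regroup (x : (Ao × Bi) × (Ai × Bo)) : (Ai × Bi) × (Ao × Bo) :=
  ((x.2.1, x.1.2), (x.1.1, x.2.2))

/-- Feasibility of `(γ, Y, J')`, with the effective Choi matrix `JE`, in the semidefinite program
for the Choi matrices `JN` and `JM`. -/
structure SDPFeasible [Fintype Ai] [DecidableEq Ai] [Fintype Ao] [DecidableEq Ao]
    [Fintype Bi] [DecidableEq Bi] [Fintype Bo] [DecidableEq Bo]
    (JN : Matrix (Ao × Bi) (Ao × Bi) ℂ) (JM : Matrix (Ai × Bo) (Ai × Bo) ℂ)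
    (γ : ℝ) (Y JE : Matrix (Ai × Bo) (Ai × Bo) ℂ)
    (J : Matrix ((Ai × Bi) × (Ao × Bo)) ((Ai × Bi) × (Ao × Bo)) ℂ) : Prop where
  trace_le : traceRight Y ≤ (γ : ℂ) • (1 : Matrix Ai Ai ℂ)
  sub_le : JE - JM ≤ Y
  nonneg : 0 ≤ Y
  effective : JE = traceLeft
    ((JN.transpose ⊗ₖ (1 : Matrix (Ai × Bo) (Ai × Bo) ℂ)) * J.submatrix regroup regroup)
  cp : 0 ≤ J
  tp : traceRight J = 1
  noSignalAB : traceAo J =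
    ((Fintype.card Ai : ℂ)⁻¹ • (1 : Matrix Ai Ai ℂ)) ⊗ₖ traceLeft (traceAo J)
  noSignalBA : traceBo J =
    ((Fintype.card Bi : ℂ)⁻¹ • (1 : Matrix Bi Bi ℂ)) ⊗ₖ traceLeft (traceBo J)

end Codes

end

end ChannelSim

/-! Taking Choi matrices identifies NS codes with the operators `J` satisfying the last four
constraints of the program (`isNSCode_iff`). It identifies the composed map with the link product of
`J` and the Choi matrix of `N` (`choi_compose_eq_traceLeft`). What remains, for a fixed code, is to
show that half the diamond norm of `Δ = compose P N - M` is the infimum of `γ` over `Y ≥ 0`, `Y ≥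
choi Δ`, `traceRight Y ≤ γ 1`. The key facts are that `choi Δ` is Hermitian and `traceRight (choi Δ)
= 0`; the latter holds because both maps are trace preserving, which for the composition rests on
the absence of signalling from B to A (`traceRight_choi_compose`).

Upper bound (`diamondNorm_le`): `Δ` is the difference of the completely positive maps with Choi
matrices `Y` and `Y - choi Δ`. These have the same marginal `traceRight Y`, so each expands trace
norms by at most `γ`.

Lower bound (`exists_dominating`): for one invertible input state, halving the sum of the output and
a matrix dominating its absolute value, then undoing the conjugation by the state, gives a `Y` that
is good for that state. Mixing in some noise handles singular states. The bound is bilinear in the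
state and `Y`, so compactness of the state set and Sion's minimax theorem give one `Y` that is good
for every state, which is the operator inequality.

All extra conditions on the code concern only its Choi matrix, so the NS and NS∩PPT cases share one
argument with a predicate `C`. -/

namespace ChannelSim

open Matrix

/-! ### Positivity, polar decomposition and the trace norm. -/

/-- A sum of a positive semidefinite matrix over index fibres is positive semidefinite. -/
theorem posSemidef_contract {n σ τ : Type*} [Fintype σ] [Fintype τ]
    {M : Matrix n n ℂ} (hM : M.PosSemidef) (f : σ → τ → n) :
    (Matrix.of fun s s' => ∑ t, ∑ t', M (f s t) (f s' t')).PosSemidef := by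
  classical
  -- Compressing by the 0/1 matrix that forgets the `τ` coordinate performs both sums at once.
  have h := (hM.submatrix (fun x : σ × τ => f x.1 x.2)).conjTranspose_mul_mul_same
    (Matrix.of fun (x : σ × τ) (s : σ) => if x.1 = s then (1 : ℂ) else 0)
  convert h using 1
  ext s s'
  simp only [Matrix.mul_apply, Matrix.of_apply, Fintype.sum_prod_type, Matrix.submatrix_apply,
    Matrix.conjTranspose_apply, mul_ite, mul_one, mul_zero, Finset.sum_ite_irrel,
    Finset.sum_const_zero, Finset.sum_ite_eq', Finset.mem_univ, if_true, apply_ite star, star_one,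
    star_zero, ite_mul, one_mul, zero_mul]
  rw [Finset.sum_comm]

/-- A Hermitian matrix has a Hermitian pseudo-inverse that commutes with it. -/
theorem exists_pseudoInverse {n : Type*} [Fintype n] [DecidableEq n] {S : Matrix n n ℂ}
    (hS : S.IsHermitian) :
    ∃ R : Matrix n n ℂ, R.IsHermitian ∧ R * S = S * R ∧ S * R * S = S ∧ R * S * R = R := by
  obtain ⟨V, μ, hV, hSp⟩ : ∃ (V : Matrix n n ℂ) (μ : n → ℝ), star V * V = 1 ∧
      S = V * diagonal (fun i => (μ i : ℂ)) * star V := by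
    refine ⟨hS.eigenvectorUnitary, hS.eigenvalues, Unitary.coe_star_mul_self _, ?_⟩
    have := hS.spectral_theorem
    rw [Unitary.conjStarAlgAut_apply] at this
    exact this
  have key : ∀ d e : n → ℂ, (V * diagonal d * star V) * (V * diagonal e * star V) =
      V * diagonal (fun i => d i * e i) * star V := by
    intro d e
    rw [← diagonal_mul_diagonal]
    calc _ = V * diagonal d * (star V * V) * diagonal e * star V := by simp only [mul_assoc]
      _ = _ := by rw [hV]; simp only [mul_assoc, mul_one]
  -- With `0⁻¹ = 0` this is the Moore–Penrose inverse.
  refine ⟨V * diagonal (fun i => ((μ i)⁻¹ : ℂ)) * star V, ?_, ?_, ?_, ?_⟩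
  · rw [Matrix.IsHermitian, conjTranspose_mul, conjTranspose_mul, diagonal_conjTranspose]
    rw [star_eq_conjTranspose, conjTranspose_conjTranspose, mul_assoc]
    congr 3
    ext i
    simp
  · rw [hSp, key, key]
    simp only [mul_comm]
  · rw [hSp, key, key]
    congr 3
    ext i
    by_cases h : (μ i : ℂ) = 0 <;> simp [h]
  · rw [hSp, key, key]
    congr 3
    ext i
    by_cases h : (μ i : ℂ) = 0 <;> simp [h]

/-- Polar decomposition of a square matrix, with a contraction as phase. -/
theorem exists_polar {n : Type*} [Fintype n] [DecidableEq n] (Z : Matrix n n ℂ) :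
    ∃ U : Matrix n n ℂ, U * CFC.sqrt (Zᴴ * Z) = Z ∧ Uᴴ * Z = CFC.sqrt (Zᴴ * Z) ∧
      (1 - U * Uᴴ).PosSemidef := by
  have hZ : 0 ≤ Zᴴ * Z := nonneg_iff_posSemidef.2 (posSemidef_conjTranspose_mul_self Z)
  have hSS : CFC.sqrt (Zᴴ * Z) * CFC.sqrt (Zᴴ * Z) = Zᴴ * Z := CFC.sqrt_mul_sqrt_self _ hZ
  have hS : (CFC.sqrt (Zᴴ * Z)).PosSemidef := nonneg_iff_posSemidef.1 (CFC.sqrt_nonneg _)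
  set S := CFC.sqrt (Zᴴ * Z)
  obtain ⟨R, hR, hRS, hSRS, hRSR⟩ := exists_pseudoInverse hS.1
  have hRR : R * (Zᴴ * Z) * R = R * S := by
    rw [← hSS]
    calc R * (S * S) * R = (R * S) * (S * R) := by simp only [mul_assoc]
      _ = (R * S * R) * S := by rw [← hRS]; simp only [mul_assoc]
      _ = _ := by rw [hRSR]
  -- `U = Z R`, with `R` the pseudo-inverse of `|Z|`, is a partial isometry: `U Uᴴ` is a Hermitian
  -- idempotent, hence so is `1 - U Uᴴ`.
  refine ⟨Z * R, ?_, ?_, ?_⟩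
  · have h : (Z * R * S - Z)ᴴ * (Z * R * S - Z) = 0 := by
      have h1 : (Z * R * S - Z)ᴴ * (Z * R * S - Z) =
          S * (R * (Zᴴ * Z) * R) * S - S * R * (Zᴴ * Z) - (Zᴴ * Z) * R * S + Zᴴ * Z := by
        rw [conjTranspose_sub, conjTranspose_mul, conjTranspose_mul, hR.eq, hS.1.eq]
        noncomm_ring
      rw [h1, hRR, ← hSS]
      have e1 : S * (R * S) * S = S * S := by rw [← mul_assoc, hSRS]
      have e2 : S * R * (S * S) = S * S := by rw [← mul_assoc, hSRS]
      have e3 : S * S * R * S = S * S := by rw [mul_assoc S S R, mul_assoc S, hSRS]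
      rw [e1, e2, e3]
      abel
    exact sub_eq_zero.1 (conjTranspose_mul_self_eq_zero.1 h)
  · rw [conjTranspose_mul, hR.eq, mul_assoc, ← hSS, ← mul_assoc, hRS, hSRS]
  · have hE : (Z * R * (Z * R)ᴴ) * (Z * R * (Z * R)ᴴ) = Z * R * (Z * R)ᴴ := by
      rw [conjTranspose_mul, hR.eq]
      calc Z * R * (R * Zᴴ) * (Z * R * (R * Zᴴ)) = Z * R * (R * (Zᴴ * Z) * R) * (R * Zᴴ) := by
            simp only [mul_assoc]
        _ = Z * R * (R * S * R) * Zᴴ := by rw [hRR]; simp only [mul_assoc]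
        _ = _ := by rw [hRSR]; simp only [mul_assoc]
    have hE' : (Z * R * (Z * R)ᴴ)ᴴ = Z * R * (Z * R)ᴴ := by
      rw [conjTranspose_mul, conjTranspose_conjTranspose]
    have h := posSemidef_conjTranspose_mul_self (1 - Z * R * (Z * R)ᴴ)
    have e : (1 - Z * R * (Z * R)ᴴ)ᴴ * (1 - Z * R * (Z * R)ᴴ) = 1 - Z * R * (Z * R)ᴴ := by
      rw [conjTranspose_sub, conjTranspose_one, hE', sub_mul, mul_sub, mul_sub, hE]
      simp
    rwa [e] at h

/-- The trace of a product of positive semidefinite matrices is nonnegative. -/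
theorem trace_mul_nonneg {n : Type*} [Fintype n] {A B : Matrix n n ℂ}
    (hA : A.PosSemidef) (hB : B.PosSemidef) : 0 ≤ (A * B).trace := by
  classical
  obtain ⟨C, rfl⟩ := CStarAlgebra.nonneg_iff_eq_star_mul_self.1 (nonneg_iff_posSemidef.2 hB)
  rw [← mul_assoc, trace_mul_comm, ← mul_assoc]
  exact (hA.mul_mul_conjTranspose_same C).trace_nonneg

/-- The trace norm is at most half the trace of any positive semidefinite dilation. -/
theorem traceNorm_le_of_fromBlocks {n : Type*} [Fintype n] [DecidableEq n] {A B Z : Matrix n n ℂ}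
    (h : (fromBlocks A Z Zᴴ B).PosSemidef) :
    2 * traceNorm Z ≤ A.trace.re + B.trace.re := by
  obtain ⟨U, -, hUZ, hU⟩ := exists_polar Z
  have hA : A.PosSemidef := by
    exact h.submatrix Sum.inl
  have hS : (CFC.sqrt (Zᴴ * Z)).PosSemidef := nonneg_iff_posSemidef.1 (CFC.sqrt_nonneg _)
  have hUZ' : Zᴴ * U = CFC.sqrt (Zᴴ * Z) := by
    have := congrArg conjTranspose hUZ
    rwa [conjTranspose_mul, conjTranspose_conjTranspose, hS.1.eq] at this
  -- Compressing by the column `(U, -1)` gives `Uᴴ A U - 2|Z| + B ≥ 0`; then `U Uᴴ ≤ 1` bounds the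
  -- trace of the first term by that of `A`.
  have h1 := h.conjTranspose_mul_mul_same (fromRows U (-1 : Matrix n n ℂ))
  have h2 : (fromRows U (-1 : Matrix n n ℂ))ᴴ * fromBlocks A Z Zᴴ B * fromRows U (-1 : Matrix n n ℂ) =
      Uᴴ * A * U - Uᴴ * Z - Zᴴ * U + B := by
    rw [conjTranspose_fromRows_eq_fromCols_conjTranspose, fromCols_mul_fromBlocks,
      fromCols_mul_fromRows]
    simp
    noncomm_ring
  rw [h2, hUZ, hUZ'] at h1
  have h3 := (Complex.le_def.1 h1.trace_nonneg).1
  have h4 := (Complex.le_def.1 (trace_mul_nonneg hA hU)).1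
  have h5 : (Uᴴ * A * U).trace = (A * (U * Uᴴ)).trace := by
    rw [mul_assoc, trace_mul_comm, mul_assoc]
  rw [mul_sub, mul_one, trace_sub] at h4
  rw [trace_add, trace_sub, trace_sub, h5] at h3
  simp only [traceNorm, Complex.add_re, Complex.sub_re, Complex.zero_re] at *
  linarith

/-- The trace norm is attained by a positive semidefinite dilation. -/
theorem exists_fromBlocks_posSemidef {n : Type*} [Fintype n] [DecidableEq n] (Z : Matrix n n ℂ) :
    ∃ A B : Matrix n n ℂ, (fromBlocks A Z Zᴴ B).PosSemidef ∧
      A.trace.re = traceNorm Z ∧ B.trace.re = traceNorm Z := by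
  obtain ⟨U, hUS, hUZ, -⟩ := exists_polar Z
  have hS : (CFC.sqrt (Zᴴ * Z)).PosSemidef := nonneg_iff_posSemidef.1 (CFC.sqrt_nonneg _)
  have hSU : CFC.sqrt (Zᴴ * Z) * Uᴴ = Zᴴ := by
    have := congrArg conjTranspose hUS
    rwa [conjTranspose_mul, hS.1.eq] at this
  refine ⟨Z * Uᴴ, CFC.sqrt (Zᴴ * Z), ?_, ?_, rfl⟩
  · have h := hS.mul_mul_conjTranspose_same (fromRows U (1 : Matrix n n ℂ))
    have e : fromRows U (1 : Matrix n n ℂ) * CFC.sqrt (Zᴴ * Z) * (fromRows U (1 : Matrix n n ℂ))ᴴ =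
        fromBlocks (Z * Uᴴ) Z Zᴴ (CFC.sqrt (Zᴴ * Z)) := by
      rw [conjTranspose_fromRows_eq_fromCols_conjTranspose, fromRows_mul,
        fromRows_mul_fromCols]
      simp [hUS, hSU]
    rwa [e] at h
  · rw [trace_mul_comm, hUZ, traceNorm]

theorem traceNorm_nonneg {n : Type*} [Fintype n] [DecidableEq n] (Z : Matrix n n ℂ) :
    0 ≤ traceNorm Z :=
  (Complex.le_def.1 (nonneg_iff_posSemidef.1 (CFC.sqrt_nonneg (Zᴴ * Z))).trace_nonneg).1

/-- The triangle inequality for differences. -/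
theorem traceNorm_sub_le {n : Type*} [Fintype n] [DecidableEq n] (X Y : Matrix n n ℂ) :
    traceNorm (X - Y) ≤ traceNorm X + traceNorm Y := by
  obtain ⟨A, B, h, hA, hB⟩ := exists_fromBlocks_posSemidef X
  obtain ⟨C, D, h', hC, hD⟩ := exists_fromBlocks_posSemidef Y
  -- Conjugation by `diag(1, -1)` turns a dilation of `Y` into one of `-Y` with the same diagonal
  -- blocks.
  have e := h'.mul_mul_conjTranspose_same (fromBlocks 1 0 0 (-1) : Matrix (n ⊕ n) (n ⊕ n) ℂ)
  have h2 := h.add e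
  rw [fromBlocks_conjTranspose, fromBlocks_multiply, fromBlocks_multiply, fromBlocks_add] at h2
  simp only [one_mul, zero_mul, add_zero, zero_add, conjTranspose_one, conjTranspose_zero,
    conjTranspose_neg, mul_one, mul_zero, mul_neg, neg_mul, neg_neg] at h2
  rw [← sub_eq_add_neg, ← sub_eq_add_neg, ← conjTranspose_sub] at h2
  have := traceNorm_le_of_fromBlocks h2
  rw [trace_add, trace_add, Complex.add_re, Complex.add_re] at this
  linarith

theorem traceNorm_of_posSemidef {n : Type*} [Fintype n] [DecidableEq n] {X : Matrix n n ℂ}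
    (hX : X.PosSemidef) : traceNorm X = X.trace.re := by
  rw [traceNorm, hX.1.eq, CFC.sqrt_mul_self X (nonneg_iff_posSemidef.2 hX)]

/-! ### Choi matrices and complete positivity. -/

section Choi

variable {m n κ : Type*} [Fintype m] [DecidableEq m]

theorem choi_apply (F : Matrix m m ℂ →ₗ[ℂ] Matrix n n ℂ) (i j : m) (p q : n) :
    choi F (i, p) (j, q) = F (Matrix.single i j 1) p q := by
  simp only [choi, Matrix.sum_apply, Matrix.kroneckerMap_apply]
  rw [Finset.sum_eq_single i, Finset.sum_eq_single j]
  · simp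
  · intro b _ hb
    simp [hb]
  · simp
  · intro b _ hb
    simp [hb]
  · simp

theorem apply_eq_sum_choi (F : Matrix m m ℂ →ₗ[ℂ] Matrix n n ℂ) (X : Matrix m m ℂ) (p q : n) :
    F X p q = ∑ i, ∑ j, X i j * choi F (i, p) (j, q) := by
  have h : X = ∑ i, ∑ j, X i j • Matrix.single i j (1 : ℂ) := by
    conv_lhs => rw [Matrix.matrix_eq_sum_single X]
    simp
  conv_lhs => rw [h]
  simp only [map_sum, map_smul, Matrix.sum_apply, Matrix.smul_apply, smul_eq_mul, choi_apply]

theorem ampliate_apply (F : Matrix m m ℂ →ₗ[ℂ] Matrix n n ℂ) (X : Matrix (m × κ) (m × κ) ℂ)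
    (u v : n × κ) :
    ampliate F κ X u v = ∑ i, ∑ j, X (i, u.2) (j, v.2) * choi F (i, u.1) (j, v.1) := by
  simp only [ampliate, LinearMap.coe_mk, AddHom.coe_mk, Matrix.of_apply]
  rw [apply_eq_sum_choi]
  rfl

/-- A map with positive semidefinite Choi matrix is completely positive. -/
theorem posSemidef_ampliate [Fintype n] [Fintype κ] {F : Matrix m m ℂ →ₗ[ℂ] Matrix n n ℂ}
    (hF : (choi F).PosSemidef) {X : Matrix (m × κ) (m × κ) ℂ} (hX : X.PosSemidef) :
    (ampliate F κ X).PosSemidef := by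
  classical
  have h := posSemidef_contract (hX.kronecker hF)
    (fun (u : n × κ) (i : m) => ((i, u.2), (i, u.1)))
  convert h using 1
  ext u v
  simp only [ampliate_apply, Matrix.of_apply, Matrix.kroneckerMap_apply]

/-- Choi's theorem. -/
theorem isCP_iff_posSemidef_choi [Fintype n] (F : Matrix m m ℂ →ₗ[ℂ] Matrix n n ℂ) :
    IsCP F ↔ (choi F).PosSemidef := by
  constructor
  · intro h
    let e := Fintype.equivFin m
    -- The unnormalized maximally entangled vector, with the reference system relabelled as a `Fin`.
    let v : m × Fin (Fintype.card m) → ℂ := fun x => if e x.1 = x.2 then 1 else 0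
    have h1 := nonneg_iff_posSemidef.1
      (h _ _ (nonneg_iff_posSemidef.2 (posSemidef_vecMulVec_self_star v)))
    have h2 : choi F = (ampliate F (Fin (Fintype.card m)) (vecMulVec v (star v))).submatrix
        (fun u : m × n => (u.2, e u.1)) (fun u : m × n => (u.2, e u.1)) := by
      ext u w
      simp [ampliate_apply, vecMulVec_apply, v, apply_ite star]
    rw [h2]
    exact h1.submatrix _
  · intro h k X hX
    exact nonneg_iff_posSemidef.2 (posSemidef_ampliate h (nonneg_iff_posSemidef.1 hX))

/-- The linear map with a given Choi matrix. -/
noncomputable def ofChoi (J : Matrix (m × n) (m × n) ℂ) : Matrix m m ℂ →ₗ[ℂ] Matrix n n ℂ where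
  toFun X := Matrix.of fun p q => ∑ i, ∑ j, X i j * J (i, p) (j, q)
  map_add' X Y := by
    ext p q
    simp [add_mul, Finset.sum_add_distrib]
  map_smul' c X := by
    ext p q
    simp [Finset.mul_sum, mul_assoc]

@[simp]
theorem choi_ofChoi (J : Matrix (m × n) (m × n) ℂ) : choi (ofChoi J) = J := by
  ext ⟨i, p⟩ ⟨j, q⟩
  rw [choi_apply]
  simp only [ofChoi, LinearMap.coe_mk, AddHom.coe_mk, Matrix.of_apply]
  rw [Finset.sum_eq_single i, Finset.sum_eq_single j]
  · simp
  · intro b _ hb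
    simp [hb.symm]
  · simp
  · intro b _ hb
    simp [hb.symm]
  · simp

theorem choi_sub (F G : Matrix m m ℂ →ₗ[ℂ] Matrix n n ℂ) : choi (F - G) = choi F - choi G := by
  ext ⟨i, p⟩ ⟨j, q⟩
  simp [choi_apply]

end Choi

theorem traceRight_sub {m n : Type*} [Fintype n] (X Y : Matrix (m × n) (m × n) ℂ) :
    traceRight (X - Y) = traceRight X - traceRight Y := by
  ext p q
  simp [traceRight]

theorem posSemidef_traceRight {m n : Type*} [Fintype n] {X : Matrix (m × n) (m × n) ℂ}
    (hX : X.PosSemidef) : (traceRight X).PosSemidef := by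
  have h := posSemidef_sum Finset.univ
    (fun (i : n) _ => hX.submatrix (fun p : m => (p, i)))
  convert h using 1
  ext p q
  simp [traceRight, Matrix.sum_apply]

theorem trace_traceRight {m n : Type*} [Fintype m] [Fintype n] (X : Matrix (m × n) (m × n) ℂ) :
    (traceRight X).trace = X.trace := by
  simp [traceRight, Matrix.trace, Fintype.sum_prod_type]

/-! ### Weak duality for the diamond norm. -/

section UpperBound

variable {m n κ : Type*} [Fintype m] [DecidableEq m] [Fintype n] [Fintype κ]

/-- The output trace sees only the marginal of the input and that of the Choi matrix, so an operator
bound on `traceRight (choi F)` controls it for every ancilla. -/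
theorem trace_ampliate (F : Matrix m m ℂ →ₗ[ℂ] Matrix n n ℂ) (X : Matrix (m × κ) (m × κ) ℂ) :
    (ampliate F κ X).trace = (traceRight X * (traceRight (choi F))ᵀ).trace := by
  simp only [Matrix.trace, Matrix.diag, Matrix.mul_apply, ampliate_apply, Fintype.sum_prod_type,
    traceRight, Matrix.of_apply, Matrix.transpose_apply, Finset.sum_mul_sum]
  simp only [← Finset.sum_product']
  refine Finset.sum_bij' (fun x _ => (x.2.2.1, x.2.2.2, x.2.1, x.1))
    (fun x _ => (x.2.2.2, x.2.2.1, x.1, x.2.1)) ?_ ?_ ?_ ?_ ?_ <;> simp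

theorem trace_ampliate_le {F : Matrix m m ℂ →ₗ[ℂ] Matrix n n ℂ} {γ : ℝ}
    (hF : traceRight (choi F) ≤ (γ : ℂ) • (1 : Matrix m m ℂ)) {X : Matrix (m × κ) (m × κ) ℂ}
    (hX : X.PosSemidef) : (ampliate F κ X).trace.re ≤ γ * X.trace.re := by
  have h := trace_mul_nonneg (posSemidef_traceRight hX) (Matrix.le_iff.1 hF).transpose
  rw [transpose_sub, mul_sub, trace_sub, ← trace_ampliate, transpose_smul, transpose_one,
    mul_smul_comm, mul_one, trace_smul, trace_traceRight] at h
  have := (Complex.le_def.1 h).1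
  simp at this
  linarith

/-- A completely positive map with `tr_n J ≤ γ 1` multiplies trace norms by at most `γ`. -/
theorem traceNorm_ampliate_le [DecidableEq n] [DecidableEq κ]
    {F : Matrix m m ℂ →ₗ[ℂ] Matrix n n ℂ} (hF : (choi F).PosSemidef) {γ : ℝ}
    (hγ : traceRight (choi F) ≤ (γ : ℂ) • (1 : Matrix m m ℂ)) (X : Matrix (m × κ) (m × κ) ℂ) :
    traceNorm (ampliate F κ X) ≤ γ * traceNorm X := by
  obtain ⟨A, B, h, hA, hB⟩ := exists_fromBlocks_posSemidef X
  -- A dilation of `X` is an operator on `m × (κ ⊕ κ)`; the doubled ancilla lets `F` act blockwise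
  -- and yields a dilation of the output.
  have h1 := (posSemidef_ampliate hF (h.submatrix (Equiv.prodSumDistrib m κ κ))).submatrix
    (Equiv.prodSumDistrib n κ κ).symm
  have e : ((ampliate F (κ ⊕ κ) ((fromBlocks A X Xᴴ B).submatrix (Equiv.prodSumDistrib m κ κ)
      (Equiv.prodSumDistrib m κ κ))).submatrix (Equiv.prodSumDistrib n κ κ).symm
      (Equiv.prodSumDistrib n κ κ).symm) =
      fromBlocks (ampliate F κ A) (ampliate F κ X) (ampliate F κ Xᴴ) (ampliate F κ B) := by
    ext (u | u) (v | v) <;> simp [ampliate_apply]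
  rw [e] at h1
  have h2 := (isHermitian_fromBlocks_iff.1 h1.1).2.1
  rw [← h2] at h1
  have h3 := traceNorm_le_of_fromBlocks h1
  have hA' : A.PosSemidef := h.submatrix Sum.inl
  have hB' : B.PosSemidef := h.submatrix Sum.inr
  have h4 := trace_ampliate_le hγ hA'
  have h5 := trace_ampliate_le hγ hB'
  rw [hA] at h4
  rw [hB] at h5
  linarith

/-- Weak duality for the diamond norm of a trace-annihilating map. -/
theorem diamondNorm_le [Nonempty m] [DecidableEq n] {Δ : Matrix m m ℂ →ₗ[ℂ] Matrix n n ℂ}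
    (h0 : traceRight (choi Δ) = 0) {Y : Matrix (m × n) (m × n) ℂ} (hY : 0 ≤ Y)
    (hYΔ : choi Δ ≤ Y) {γ : ℝ} (hγ : traceRight Y ≤ (γ : ℂ) • (1 : Matrix m m ℂ)) :
    diamondNorm Δ ≤ ((2 * γ : ℝ) : EReal) := by
  -- Needed to pass from `traceNorm X ≤ 1` to `γ * traceNorm X ≤ γ`.
  have hγ0 : 0 ≤ γ := by
    obtain ⟨i⟩ := ‹Nonempty m›
    have h := ((posSemidef_traceRight (nonneg_iff_posSemidef.1 hY)).add (Matrix.le_iff.1 hγ))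
    rw [add_sub_cancel] at h
    have := (Complex.le_def.1 (h.diag_nonneg (i := i))).1
    simpa using this
  refine iSup_le fun k => iSup_le fun X => iSup_le fun hX => ?_
  rw [EReal.coe_le_coe_iff]
  have hsub : ampliate Δ (Fin k) X =
      ampliate (ofChoi Y) (Fin k) X - ampliate (ofChoi (Y - choi Δ)) (Fin k) X := by
    ext u v
    simp only [Matrix.sub_apply, ampliate_apply, choi_ofChoi, ← Finset.sum_sub_distrib]
    simp [mul_sub]
  have h1 := traceNorm_ampliate_le (F := ofChoi Y) (γ := γ)
    (by rw [choi_ofChoi]; exact nonneg_iff_posSemidef.1 hY) (by rwa [choi_ofChoi]) X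
  have h2 := traceNorm_ampliate_le (F := ofChoi (Y - choi Δ)) (γ := γ)
    (by rw [choi_ofChoi]; exact Matrix.le_iff.1 hYΔ)
    (by rwa [choi_ofChoi, traceRight_sub, h0, sub_zero]) X
  rw [hsub]
  have h3 := traceNorm_sub_le (ampliate (ofChoi Y) (Fin k) X)
    (ampliate (ofChoi (Y - choi Δ)) (Fin k) X)
  have h4 := mul_le_mul_of_nonneg_left hX hγ0
  linarith

end UpperBound

/-! ### Strong duality: a dominating operator for a fixed input state. -/

/-- A Hermitian matrix `W` is dominated in absolute value by a matrix of trace `‖W‖₁`. -/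
theorem exists_abs_le_of_isHermitian {n : Type*} [Fintype n] [DecidableEq n] {W : Matrix n n ℂ}
    (hW : W.IsHermitian) :
    ∃ T : Matrix n n ℂ, (T + W).PosSemidef ∧ (T - W).PosSemidef ∧ T.trace.re = traceNorm W := by
  obtain ⟨A, B, h, hA, hB⟩ := exists_fromBlocks_posSemidef W
  -- Compressing the dilation by the row `(1, c)` with `c = ±1` gives `A + B ± 2W ≥ 0`, so `T = (A +
  -- B) / 2` works.
  have key : ∀ c : Matrix n n ℂ, (A + c * Wᴴ + (W * cᴴ + c * B * cᴴ)).PosSemidef := by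
    intro c
    have h1 := h.mul_mul_conjTranspose_same (fromCols (1 : Matrix n n ℂ) c)
    rw [conjTranspose_fromCols_eq_fromRows_conjTranspose, fromCols_mul_fromBlocks,
      fromCols_mul_fromRows] at h1
    simpa [add_mul] using h1
  have hhalf : (0 : ℂ) ≤ 1 / 2 := by
    rw [Complex.le_def]; norm_num
  refine ⟨(1 / 2 : ℂ) • (A + B), ?_, ?_, ?_⟩
  · have h1 := (key 1).smul hhalf
    convert h1 using 1
    rw [hW.eq]
    simp
    module
  · have h1 := (key (-1)).smul hhalf
    convert h1 using 1
    rw [hW.eq]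
    simp
    module
  · simp [hA, hB]
    ring

theorem trace_kronecker_one_mul {m n : Type*} [Fintype m] [Fintype n] [DecidableEq n]
    (ρ : Matrix m m ℂ) (Y : Matrix (m × n) (m × n) ℂ) :
    ((ρ ⊗ₖ (1 : Matrix n n ℂ)) * Y).trace = (ρ * traceRight Y).trace := by
  simp only [Matrix.trace, Matrix.diag, Matrix.mul_apply, Fintype.sum_prod_type, traceRight,
    Matrix.of_apply, Matrix.kroneckerMap_apply, Matrix.one_apply, mul_ite, mul_one, mul_zero,
    ite_mul, zero_mul, Finset.sum_ite_eq, Finset.mem_univ, if_true, Finset.mul_sum]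
  exact Finset.sum_congr rfl fun i _ => Finset.sum_comm

section LowerBound

variable {m n : Type*} [Fintype m] [DecidableEq m] [Fintype n] [DecidableEq n]

/-- For a fixed invertible input state, the dual problem is solved by a Jordan-type
decomposition of the output. -/
theorem exists_dominating_of_invertible {Δ : Matrix m m ℂ →ₗ[ℂ] Matrix n n ℂ}
    (hΔ : (choi Δ).IsHermitian) (h0 : traceRight (choi Δ) = 0) {d : ℝ}
    (hd : diamondNorm Δ ≤ ((2 * d : ℝ) : EReal)) {K L : Matrix m m ℂ} (hKL : L * K = 1)
    (hK : (Kᴴ * K).trace = 1) :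
    ∃ Y : Matrix (m × n) (m × n) ℂ, Y.PosSemidef ∧ (Y - choi Δ).PosSemidef ∧
      (Kᴴ * K * traceRight Y).trace.re ≤ d := by
  let e := Fintype.equivFin m
  -- The entries of `K` form a purification of the transpose of `Kᴴ K`; the output of `Δ` on it is
  -- `choi Δ` conjugated by `K ⊗ 1`.
  let v : m × Fin (Fintype.card m) → ℂ := fun x => K (e.symm x.2) x.1
  let X := vecMulVec v (star v)
  have hX : X.PosSemidef := posSemidef_vecMulVec_self_star v
  have hXt : X.trace = 1 := by
    rw [← hK]
    simp only [X, v, Matrix.trace, Matrix.diag, vecMulVec_apply, Fintype.sum_prod_type,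
      Matrix.mul_apply, conjTranspose_apply, Pi.star_apply]
    refine Finset.sum_congr rfl fun i _ => ?_
    rw [← e.symm.sum_comp]
    exact Finset.sum_congr rfl fun j _ => mul_comm _ _
  have hW1 : traceNorm (ampliate Δ (Fin (Fintype.card m)) X) ≤ 2 * d := by
    rw [← EReal.coe_le_coe_iff]
    refine le_trans ?_ hd
    have h1 : traceNorm X ≤ 1 := by
      rw [traceNorm_of_posSemidef hX, hXt, Complex.one_re]
    exact le_iSup_of_le (Fintype.card m) (le_iSup_of_le X (le_iSup_of_le h1 le_rfl))
  let E : m × n ≃ n × Fin (Fintype.card m) := (Equiv.prodComm m n).trans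
    (Equiv.prodCongr (Equiv.refl n) e)
  let K' : Matrix (m × n) (m × n) ℂ := K ⊗ₖ (1 : Matrix n n ℂ)
  let L' : Matrix (m × n) (m × n) ℂ := L ⊗ₖ (1 : Matrix n n ℂ)
  have hLK : L' * K' = 1 := by
    simp only [L', K']
    rw [← mul_kronecker_mul, hKL, one_mul, one_kronecker_one]
  have hKL' : K' * L' = 1 := mul_eq_one_comm.1 hLK
  have hWsub : (ampliate Δ (Fin (Fintype.card m)) X).submatrix E E = K' * choi Δ * K'ᴴ := by
    ext ⟨x, p⟩ ⟨y, q⟩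
    simp only [submatrix_apply, ampliate_apply, X, v, E, K', Matrix.mul_apply, vecMulVec_apply,
      Fintype.sum_prod_type, conjTranspose_apply, kroneckerMap_apply, Matrix.one_apply,
      Equiv.trans_apply, Equiv.prodComm_apply, Equiv.prodCongr_apply, Prod.map, Prod.swap,
      Equiv.refl_apply, Equiv.symm_apply_apply, Pi.star_apply]
    simp [Finset.sum_mul, apply_ite star]
    rw [Finset.sum_comm]
    exact Finset.sum_congr rfl fun i _ => Finset.sum_congr rfl fun j _ => by ring
  have hKher : (K' * choi Δ * K'ᴴ).IsHermitian := isHermitian_mul_mul_conjTranspose _ hΔ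
  have hWher : (ampliate Δ (Fin (Fintype.card m)) X).IsHermitian := by
    rw [← hWsub] at hKher
    have := hKher.submatrix E.symm
    simpa using this
  obtain ⟨T, hT1, hT2, hT⟩ := exists_abs_le_of_isHermitian hWher
  have hS1 := hT1.submatrix E
  have hS2 := hT2.submatrix E
  rw [submatrix_add, Pi.add_apply, Pi.add_apply, hWsub] at hS1
  rw [submatrix_sub, Pi.sub_apply, Pi.sub_apply, hWsub] at hS2
  have hST : (T.submatrix E E).trace.re ≤ 2 * d := by
    have : (T.submatrix E E).trace = T.trace := by
      simp only [Matrix.trace, Matrix.diag, submatrix_apply]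
      exact E.sum_comp fun x => T x x
    rw [this, hT]
    exact hW1
  set S := T.submatrix E E
  have hhalf : (0 : ℂ) ≤ 1 / 2 := by
    rw [Complex.le_def]; norm_num
  have hcycle : ∀ Z : Matrix (m × n) (m × n) ℂ,
      (K' * Z * K'ᴴ).trace = (Kᴴ * K * traceRight Z).trace := by
    intro Z
    rw [← trace_kronecker_one_mul, mul_assoc, trace_mul_comm, mul_assoc, trace_mul_comm]
    congr 2
    rw [conjTranspose_kronecker, ← mul_kronecker_mul, conjTranspose_one, one_mul]
  have hcancel : ∀ Z : Matrix (m × n) (m × n) ℂ, L' * (K' * Z * K'ᴴ) * L'ᴴ = Z := by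
    intro Z
    have h2 : K'ᴴ * L'ᴴ = 1 := by rw [← conjTranspose_mul, hLK, conjTranspose_one]
    calc _ = (L' * K') * Z * (K'ᴴ * L'ᴴ) := by simp only [mul_assoc]
      _ = Z := by rw [hLK, h2, one_mul, mul_one]
  have hcancel' : ∀ Z : Matrix (m × n) (m × n) ℂ, K' * (L' * Z * L'ᴴ) * K'ᴴ = Z := by
    intro Z
    have h2 : L'ᴴ * K'ᴴ = 1 := by rw [← conjTranspose_mul, hKL', conjTranspose_one]
    calc _ = (K' * L') * Z * (L'ᴴ * K'ᴴ) := by simp only [mul_assoc]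
      _ = Z := by rw [hKL', h2, one_mul, mul_one]
  -- With `W` the output and `S ≥ ±W`, take `(S + W) / 2` and undo the conjugation; subtracting
  -- `choi Δ` leaves the conjugate of `(S - W) / 2`. The trace of `W` vanishes by `h0`, so only half
  -- of `tr S ≤ 2d` counts.
  refine ⟨L' * ((1 / 2 : ℂ) • (S + K' * choi Δ * K'ᴴ)) * L'ᴴ,
    (hS1.smul hhalf).mul_mul_conjTranspose_same L', ?_, ?_⟩
  · have h1 := (hS2.smul hhalf).mul_mul_conjTranspose_same L'
    convert h1 using 1
    conv_lhs => rw [← hcancel (choi Δ)]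
    rw [← sub_mul, ← mul_sub, hcancel]
    congr 2
    module
  · rw [← hcycle, hcancel', trace_smul, trace_add, hcycle, h0, mul_zero, trace_zero, add_zero]
    simp
    linarith

/-! ### Strong duality: from single states to all states by minimax. -/

/-- The set of states, as a set of matrices, is compact. -/
theorem isCompact_setOf_isState : IsCompact {ρ : Matrix m m ℂ | IsState ρ} := by
  have h1 : IsCompact {C : Matrix m m ℂ | (Cᴴ * C).trace = 1} := by
    refine IsCompact.of_isClosed_subset
      (isCompact_univ_pi fun _ : m => isCompact_univ_pi fun _ : m =>
        isCompact_closedBall (0 : ℂ) 1) ?_ ?_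
    · exact isClosed_eq (by fun_prop) continuous_const
    · intro C hC i _ j _
      have h2 : ∑ a, ∑ b, ‖C b a‖ ^ 2 = 1 := by
        have h3 := congrArg Complex.re (Set.mem_ofPred_eq ▸ hC)
        rw [Complex.one_re] at h3
        rw [← h3]
        simp only [Matrix.trace, Matrix.diag, Matrix.mul_apply, conjTranspose_apply, Complex.re_sum]
        refine Finset.sum_congr rfl fun a _ => Finset.sum_congr rfl fun b _ => ?_
        rw [Complex.star_def, ← Complex.normSq_eq_conj_mul_self, Complex.ofReal_re,
          Complex.normSq_eq_norm_sq]
      have h4 : ‖C i j‖ ^ 2 ≤ 1 := by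
        rw [← h2]
        refine le_trans ?_ (Finset.single_le_sum (f := fun a => ∑ b, ‖C b a‖ ^ 2)
          (fun a _ => by positivity) (Finset.mem_univ j))
        exact Finset.single_le_sum (f := fun b => ‖C b j‖ ^ 2)
          (fun a _ => by positivity) (Finset.mem_univ i)
      rw [mem_closedBall_zero_iff]
      exact (sq_le_one_iff₀ (norm_nonneg _)).1 h4
  have h2 : {ρ : Matrix m m ℂ | IsState ρ} = (fun C : Matrix m m ℂ => Cᴴ * C) ''
      {C : Matrix m m ℂ | (Cᴴ * C).trace = 1} := by
    ext ρ
    constructor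
    · rintro ⟨hρ, ht⟩
      obtain ⟨C, rfl⟩ := CStarAlgebra.nonneg_iff_eq_star_mul_self.1 hρ
      exact ⟨C, ht, rfl⟩
    · rintro ⟨C, hC, rfl⟩
      exact ⟨nonneg_iff_posSemidef.2 (posSemidef_conjTranspose_mul_self C), hC⟩
  rw [h2]
  exact h1.image (by fun_prop)

theorem isState_maximallyMixed [Nonempty m] :
    IsState ((Fintype.card m : ℂ)⁻¹ • (1 : Matrix m m ℂ)) := by
  constructor
  · refine nonneg_iff_posSemidef.2 (PosSemidef.one.smul ?_)
    exact inv_nonneg.2 (Nat.cast_nonneg _)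
  · simp

/-- For every input state, the dual problem has value at most the norm. -/
theorem exists_dominating_of_isState [Nonempty m] {Δ : Matrix m m ℂ →ₗ[ℂ] Matrix n n ℂ}
    (hΔ : (choi Δ).IsHermitian) (h0 : traceRight (choi Δ) = 0) {d : ℝ} (hd0 : 0 ≤ d)
    (hd : diamondNorm Δ ≤ ((2 * d : ℝ) : EReal)) {ε : ℝ} (hε : 0 < ε) {ρ : Matrix m m ℂ}
    (hρ : IsState ρ) :
    ∃ Y : Matrix (m × n) (m × n) ℂ, Y.PosSemidef ∧ (Y - choi Δ).PosSemidef ∧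
      (ρ * traceRight Y).trace.re < d + ε := by
  -- `δ` is the weight of the maximally mixed state, which makes the mixture invertible; this choice
  -- makes `(1 - δ)(d + ε)` exceed `d`.
  have hδ : 0 < ε / (2 * (d + ε)) := by positivity
  have hδ1 : (1 - ε / (2 * (d + ε))) * (d + ε) = d + ε / 2 := by
    field_simp
    ring
  set δ := ε / (2 * (d + ε))
  have hδ2 : 0 < 1 - δ := pos_of_mul_pos_left (hδ1 ▸ by positivity : 0 < (1 - δ) * (d + ε))
    (by positivity)
  set τ := (Fintype.card m : ℂ)⁻¹ • (1 : Matrix m m ℂ) with hτ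
  have hτd : τ.PosDef := PosDef.one.smul (inv_pos.2 (Nat.cast_pos.2 Fintype.card_pos))
  have hσd : (((1 - δ : ℝ) : ℂ) • ρ + (δ : ℂ) • τ).PosDef :=
    PosDef.posSemidef_add ((nonneg_iff_posSemidef.1 hρ.1).smul
      (by exact_mod_cast hδ2.le)) (hτd.smul (by exact_mod_cast hδ))
  have hσt : (((1 - δ : ℝ) : ℂ) • ρ + (δ : ℂ) • τ).trace = 1 := by
    rw [trace_add, trace_smul, trace_smul, hρ.2, isState_maximallyMixed.2]
    push_cast
    simp
  obtain ⟨K, hK⟩ := CStarAlgebra.nonneg_iff_eq_star_mul_self.1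
    (nonneg_iff_posSemidef.2 hσd.posSemidef)
  rw [star_eq_conjTranspose] at hK
  have hKu : IsUnit K.det := by
    have := (Matrix.isUnit_iff_isUnit_det _).1 hσd.isUnit
    rw [hK, det_mul] at this
    exact isUnit_of_mul_isUnit_right this
  obtain ⟨Y, hY, hYΔ, hYt⟩ := exists_dominating_of_invertible hΔ h0 hd
    (Matrix.nonsing_inv_mul K hKu) (by rw [← hK, hσt])
  refine ⟨Y, hY, hYΔ, ?_⟩
  have hτY := (Complex.le_def.1 (trace_mul_nonneg hτd.posSemidef (posSemidef_traceRight hY))).1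
  rw [← hK, add_mul, trace_add, smul_mul_assoc, smul_mul_assoc, trace_smul, trace_smul,
    Complex.add_re, smul_eq_mul, smul_eq_mul, Complex.re_ofReal_mul, Complex.re_ofReal_mul] at hYt
  rw [Complex.zero_re] at hτY
  have h1 : (1 - δ) * (ρ * traceRight Y).trace.re < (1 - δ) * (d + ε) := by
    rw [hδ1]
    have := mul_nonneg hδ.le hτY
    linarith
  exact lt_of_mul_lt_mul_left h1 hδ2.le

/-- A Hermitian matrix with nonnegative expectation in every state is positive semidefinite. -/
theorem posSemidef_of_isState {M : Matrix m m ℂ} (hM : M.IsHermitian)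
    (h : ∀ ρ, IsState ρ → 0 ≤ (ρ * M).trace.re) : M.PosSemidef := by
  refine PosSemidef.of_dotProduct_mulVec_nonneg hM fun x => ?_
  have him : (star x ⬝ᵥ M *ᵥ x).im = 0 := hM.im_star_dotProduct_mulVec_self x
  have hx : (vecMulVec x (star x)).PosSemidef := posSemidef_vecMulVec_self_star x
  have hxM : (vecMulVec x (star x) * M).trace = star x ⬝ᵥ M *ᵥ x := by
    rw [vecMulVec_mul, trace_vecMulVec, dotProduct_comm, dotProduct_mulVec]
  have hre : 0 ≤ (star x ⬝ᵥ M *ᵥ x).re := by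
    by_cases h0 : (vecMulVec x (star x)).trace = 0
    · rw [hx.trace_eq_zero_iff] at h0
      rw [← hxM, h0]
      simp
    · have hpos : 0 < (vecMulVec x (star x)).trace := lt_of_le_of_ne hx.trace_nonneg (Ne.symm h0)
      have h1 := h ((vecMulVec x (star x)).trace⁻¹ • vecMulVec x (star x))
        ⟨nonneg_iff_posSemidef.2 (hx.smul (inv_nonneg.2 hpos.le)), by
          rw [trace_smul, smul_eq_mul, inv_mul_cancel₀ h0]⟩
      obtain ⟨t, ht⟩ : ∃ t : ℝ, (vecMulVec x (star x)).trace = (t : ℂ) :=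
        ⟨_, Complex.eq_re_of_ofReal_le (r := 0) (by simp)⟩
      rw [ht] at hpos
      have ht0 : 0 < t := by exact_mod_cast hpos
      rw [smul_mul_assoc, trace_smul, hxM, ht, smul_eq_mul, ← Complex.ofReal_inv,
        Complex.re_ofReal_mul] at h1
      exact nonneg_of_mul_nonneg_right h1 (inv_pos.2 ht0)
  exact Complex.le_def.2 ⟨hre, him.symm⟩

/-- Strong duality for the diamond norm of a Hermiticity-preserving trace-annihilating map. -/
theorem exists_dominating [Nonempty m] {Δ : Matrix m m ℂ →ₗ[ℂ] Matrix n n ℂ}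
    (hΔ : (choi Δ).IsHermitian) (h0 : traceRight (choi Δ) = 0) {d : ℝ} (hd0 : 0 ≤ d)
    (hd : diamondNorm Δ ≤ ((2 * d : ℝ) : EReal)) {ε : ℝ} (hε : 0 < ε) :
    ∃ Y : Matrix (m × n) (m × n) ℂ, 0 ≤ Y ∧ choi Δ ≤ Y ∧
      traceRight Y ≤ ((d + ε : ℝ) : ℂ) • (1 : Matrix m m ℂ) := by
  -- The sign makes states the minimizing side, where Sion's theorem needs compactness; the set of
  -- `Y` is unbounded in general.
  let f : Matrix m m ℂ → Matrix (m × n) (m × n) ℂ → ℝ := fun ρ Y => -(ρ * traceRight Y).trace.re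
  let 𝒳 : Set (Matrix m m ℂ) := {ρ | IsState ρ}
  let 𝒴 : Set (Matrix (m × n) (m × n) ℂ) := {Y | Y.PosSemidef ∧ (Y - choi Δ).PosSemidef}
  have hfρ : ∀ Y, Continuous fun ρ => f ρ Y := fun Y => by fun_prop
  have hfY : ∀ ρ, Continuous fun Y => f ρ Y := fun ρ => by
    have : Continuous fun Y : Matrix (m × n) (m × n) ℂ => traceRight Y := by
      unfold traceRight
      fun_prop
    fun_prop
  have hfρl : ∀ Y (a b : ℝ) ρ σ, f (a • ρ + b • σ) Y = a * f ρ Y + b * f σ Y := by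
    intro Y a b ρ σ
    simp [f, add_mul]
    ring
  have hfYl : ∀ ρ (a b : ℝ) Y Z, f ρ (a • Y + b • Z) = a * f ρ Y + b * f ρ Z := by
    intro ρ a b Y Z
    have : traceRight (a • Y + b • Z) = a • traceRight Y + b • traceRight Z := by
      ext i j
      simp [traceRight, Finset.sum_add_distrib, Finset.mul_sum]
    simp [f, mul_add, this]
    ring
  have c𝒳 : Convex ℝ 𝒳 := by
    intro ρ hρ σ hσ a b ha hb hab
    refine ⟨nonneg_iff_posSemidef.2 (((nonneg_iff_posSemidef.1 hρ.1).smul ha).add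
      ((nonneg_iff_posSemidef.1 hσ.1).smul hb)), ?_⟩
    rw [trace_add, trace_smul, trace_smul, hρ.2, hσ.2, ← add_smul, hab, one_smul]
  have c𝒴 : Convex ℝ 𝒴 := by
    intro Y hY Z hZ a b ha hb hab
    refine ⟨(hY.1.smul ha).add (hZ.1.smul hb), ?_⟩
    have : a • Y + b • Z - choi Δ = a • (Y - choi Δ) + b • (Z - choi Δ) := by
      conv_lhs => rw [← one_smul ℝ (choi Δ), ← hab]
      module
    rw [this]
    exact (hY.2.smul ha).add (hZ.2.smul hb)
  have hpt : ∀ ρ ∈ 𝒳, ∃ Y ∈ 𝒴, -(d + ε) < f ρ Y := by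
    intro ρ hρ
    obtain ⟨Y, hY1, hY2, hY3⟩ := exists_dominating_of_isState hΔ h0 hd0 hd hε hρ
    exact ⟨Y, ⟨hY1, hY2⟩, neg_lt_neg hY3⟩
  -- The strict slack `ε` makes the sets of states served by one `Y` open, so finitely many `Y`
  -- serve all states.
  obtain ⟨s, hs𝒴, hsf, hs⟩ := (isCompact_setOf_isState (m := m)).elim_finite_subcover_image
    (b := 𝒴) (c := fun Y => {ρ | -(d + ε) < f ρ Y})
    (fun Y _ => isOpen_lt continuous_const (hfρ Y))
    (fun ρ hρ => by
      obtain ⟨Y, hY, h⟩ := hpt ρ hρ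
      exact Set.mem_biUnion hY h)
  obtain ⟨Y, hY, hYf⟩ := Sion.exists_lt_iInf_of_lt_iInf_of_finite (X := 𝒳) (Y := 𝒴) (f := f)
    ⟨_, isState_maximallyMixed⟩ isCompact_setOf_isState
    (fun Y _ => (hfρ Y).lowerSemicontinuous.lowerSemicontinuousOn _)
    (fun Y _ => ConvexOn.quasiconvexOn
      ⟨c𝒳, fun ρ _ σ _ a b _ _ _ => (hfρl Y a b ρ σ).le⟩)
    c𝒴
    (fun ρ _ => (hfY ρ).upperSemicontinuous.upperSemicontinuousOn _)
    (fun ρ _ => ConcaveOn.quasiconcaveOn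
      ⟨c𝒴, fun Y _ Z _ a b _ _ _ => (hfYl ρ a b Y Z).ge⟩)
    c𝒳 hsf hs𝒴 (t := -(d + ε))
    (fun ρ hρ => by simpa using hs hρ)
  refine ⟨Y, nonneg_iff_posSemidef.2 hY.1, Matrix.le_iff.2 hY.2, Matrix.le_iff.2 ?_⟩
  refine posSemidef_of_isState ?_ fun ρ hρ => ?_
  · exact (isHermitian_one.smul (Complex.conj_ofReal _)).sub (posSemidef_traceRight hY.1).1
  · have h1 := hYf ρ hρ
    rw [mul_sub, mul_smul_comm, mul_one, trace_sub, trace_smul, hρ.2]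
    simp only [f] at h1
    simp
    linarith

end LowerBound

/-! ### Code conditions in terms of Choi matrices. -/

/-- A linear map is constant on states iff it factors through the trace. -/
theorem forall_isState_eq_iff {m V : Type*} [Fintype m] [DecidableEq m] [Nonempty m]
    [AddCommGroup V] [Module ℂ V] (L : Matrix m m ℂ →ₗ[ℂ] V) :
    (∀ ρ₁ ρ₂, IsState ρ₁ → IsState ρ₂ → L ρ₁ = L ρ₂) ↔
      ∀ i j, L (Matrix.single i j 1) =
        ((Fintype.card m : ℂ)⁻¹ * (1 : Matrix m m ℂ) i j) • L 1 := by
  have htr : ∀ i j : m, (Matrix.single i j (1 : ℂ)).trace = (1 : Matrix m m ℂ) i j := by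
    intro i j
    by_cases h : i = j
    · subst h
      simp
    · simp [h, Matrix.trace_single_eq_of_ne]
  let T : Matrix m m ℂ →ₗ[ℂ] V :=
    (traceLinearMap m ℂ ℂ).smulRight ((Fintype.card m : ℂ)⁻¹ • L 1)
  have hT : ∀ X, T X = X.trace • ((Fintype.card m : ℂ)⁻¹ • L 1) := fun X => rfl
  constructor
  · intro h
    -- Positive matrices span, and a nonzero one is a multiple of a state, on which `L` takes its
    -- value at the maximally mixed state.
    have hLT : L = T := by
      refine LinearMap.ext_on (CStarAlgebra.span_nonneg (A := Matrix m m ℂ)) ?_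
      intro X hX
      have hX' : X.PosSemidef := nonneg_iff_posSemidef.1 hX
      rw [hT]
      by_cases h0 : X.trace = 0
      · rw [hX'.trace_eq_zero_iff.1 h0]
        simp
      · have h1 := h (X.trace⁻¹ • X) _
          ⟨nonneg_iff_posSemidef.2 (hX'.smul (inv_nonneg.2 hX'.trace_nonneg)), by
            rw [trace_smul, smul_eq_mul, inv_mul_cancel₀ h0]⟩ isState_maximallyMixed
        rw [map_smul, map_smul] at h1
        rw [← h1, smul_smul, mul_inv_cancel₀ h0, one_smul]
    intro i j
    conv_lhs => rw [hLT, hT, htr, smul_smul, mul_comm]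
  · intro h
    have hLT : L = T := by
      refine Matrix.ext_linearMap _ fun i j => LinearMap.ext_ring ?_
      simp only [LinearMap.comp_apply, Matrix.singleLinearMap_apply]
      rw [h, hT, htr, smul_smul, mul_comm]
    intro ρ₁ ρ₂ h₁ h₂
    rw [hLT, hT, hT, h₁.2, h₂.2]

theorem single_prod_eq_kronecker {m n : Type*} [DecidableEq m] [DecidableEq n]
    (i j : m) (k l : n) :
    (Matrix.single (i, k) (j, l) 1 : Matrix (m × n) (m × n) ℂ) =
      Matrix.single i j 1 ⊗ₖ Matrix.single k l 1 := by
  ext ⟨a, b⟩ ⟨c, d⟩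
  simp only [Matrix.single_apply, kroneckerMap_apply, Prod.mk.injEq, mul_ite, mul_one, mul_zero,
    ← ite_and]
  congr 1
  exact propext (by tauto)

/-- Trace preservation in terms of the Choi matrix. -/
theorem isTP_iff_traceRight_choi {m n : Type*} [Fintype m] [DecidableEq m] [Fintype n]
    (F : Matrix m m ℂ →ₗ[ℂ] Matrix n n ℂ) : IsTP F ↔ traceRight (choi F) = 1 := by
  have hentry : ∀ i j, traceRight (choi F) i j = (F (Matrix.single i j 1)).trace := by
    intro i j
    simp [traceRight, choi_apply, Matrix.trace]
  have htr : ∀ i j : m, (Matrix.single i j (1 : ℂ)).trace = (1 : Matrix m m ℂ) i j := by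
    intro i j
    by_cases h : i = j
    · subst h
      simp
    · simp [h, Matrix.trace_single_eq_of_ne]
  constructor
  · intro h
    ext i j
    rw [hentry, h, htr]
  · intro h
    have hL : traceLinearMap n ℂ ℂ ∘ₗ F = traceLinearMap m ℂ ℂ := by
      refine Matrix.ext_linearMap _ fun i j => LinearMap.ext_ring ?_
      simp only [LinearMap.comp_apply, Matrix.singleLinearMap_apply, traceLinearMap_apply]
      rw [← hentry, h, htr]
    exact fun X => LinearMap.congr_fun hL X

section Codes

variable {Ai Ao Bi Bo : Type*} [Fintype Ai] [DecidableEq Ai] [Fintype Bi] [DecidableEq Bi]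

/-- Curried as a map from A-inputs to linear maps on B-inputs, the code must be constant on states.
By `forall_isState_eq_iff` this can be tested on matrix units, whose images are the entries of the
Choi matrix. -/
theorem noSignalAB_iff [Nonempty Ai] [Fintype Ao]
    (P : Matrix (Ai × Bi) (Ai × Bi) ℂ →ₗ[ℂ] Matrix (Ao × Bo) (Ao × Bo) ℂ) :
    NoSignalAB P ↔ traceAo (choi P) =
      ((Fintype.card Ai : ℂ)⁻¹ • (1 : Matrix Ai Ai ℂ)) ⊗ₖ traceLeft (traceAo (choi P)) := by
  let B : Matrix Ai Ai ℂ →ₗ[ℂ] Matrix Bi Bi ℂ →ₗ[ℂ] Matrix Bo Bo ℂ :=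
    LinearMap.mk₂ ℂ (fun X Y => traceLeft (P (X ⊗ₖ Y)))
      (fun X Y Z => by
        ext; simp [add_kronecker, traceLeft, Finset.sum_add_distrib])
      (fun c X Y => by
        ext; simp [smul_kronecker, traceLeft, Finset.mul_sum])
      (fun X Y Z => by
        ext; simp [kronecker_add, traceLeft, Finset.sum_add_distrib])
      (fun c X Y => by
        ext; simp [kronecker_smul, traceLeft, Finset.mul_sum])
  have hB : ∀ X Y, B X Y = traceLeft (P (X ⊗ₖ Y)) := fun X Y => rfl
  have h1 : NoSignalAB P ↔ ∀ ρ₁ ρ₂, IsState ρ₁ → IsState ρ₂ → B ρ₁ = B ρ₂ := by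
    simp only [NoSignalAB, LinearMap.ext_iff, hB]
  have hent : ∀ i j k l p q, traceAo (choi P) (i, k, p) (j, l, q) =
      B (Matrix.single i j 1) (Matrix.single k l 1) p q := by
    intro i j k l p q
    simp [hB, traceAo, traceLeft, choi_apply, single_prod_eq_kronecker]
  have hsum : ∀ k l p q, traceLeft (traceAo (choi P)) (k, p) (l, q) =
      B 1 (Matrix.single k l 1) p q := by
    intro k l p q
    rw [← Matrix.sum_single_one]
    simp [traceLeft, hent, Matrix.sum_apply]
  rw [h1, forall_isState_eq_iff]
  constructor
  · intro h
    ext ⟨i, k, p⟩ ⟨j, l, q⟩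
    rw [hent, h, kroneckerMap_apply, hsum]
    simp
  · intro h i j
    refine Matrix.ext_linearMap _ fun k l => LinearMap.ext_ring ?_
    simp only [LinearMap.comp_apply, Matrix.singleLinearMap_apply]
    ext p q
    rw [← hent, h, kroneckerMap_apply, hsum]
    simp

theorem noSignalBA_iff [Nonempty Bi] [Fintype Bo]
    (P : Matrix (Ai × Bi) (Ai × Bi) ℂ →ₗ[ℂ] Matrix (Ao × Bo) (Ao × Bo) ℂ) :
    NoSignalBA P ↔ traceBo (choi P) =
      ((Fintype.card Bi : ℂ)⁻¹ • (1 : Matrix Bi Bi ℂ)) ⊗ₖ traceLeft (traceBo (choi P)) := by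
  let B : Matrix Bi Bi ℂ →ₗ[ℂ] Matrix Ai Ai ℂ →ₗ[ℂ] Matrix Ao Ao ℂ :=
    LinearMap.mk₂ ℂ (fun X Y => traceRight (P (Y ⊗ₖ X)))
      (fun X Y Z => by
        ext; simp [kronecker_add, traceRight, Finset.sum_add_distrib])
      (fun c X Y => by
        ext; simp [kronecker_smul, traceRight, Finset.mul_sum])
      (fun X Y Z => by
        ext; simp [add_kronecker, traceRight, Finset.sum_add_distrib])
      (fun c X Y => by
        ext; simp [smul_kronecker, traceRight, Finset.mul_sum])
  have hB : ∀ X Y, B X Y = traceRight (P (Y ⊗ₖ X)) := fun X Y => rfl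
  have h1 : NoSignalBA P ↔ ∀ ρ₁ ρ₂, IsState ρ₁ → IsState ρ₂ → B ρ₁ = B ρ₂ := by
    simp only [NoSignalBA, LinearMap.ext_iff, hB]
  have hent : ∀ i j k l a b, traceBo (choi P) (k, i, a) (l, j, b) =
      B (Matrix.single k l 1) (Matrix.single i j 1) a b := by
    intro i j k l a b
    simp [hB, traceBo, traceRight, choi_apply, single_prod_eq_kronecker]
  have hsum : ∀ i j a b, traceLeft (traceBo (choi P)) (i, a) (j, b) =
      B 1 (Matrix.single i j 1) a b := by
    intro i j a b
    rw [← Matrix.sum_single_one]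
    simp [traceLeft, hent, Matrix.sum_apply]
  rw [h1, forall_isState_eq_iff]
  constructor
  · intro h
    ext ⟨k, i, a⟩ ⟨l, j, b⟩
    rw [hent, h, kroneckerMap_apply, hsum]
    simp
  · intro h k l
    refine Matrix.ext_linearMap _ fun i j => LinearMap.ext_ring ?_
    simp only [LinearMap.comp_apply, Matrix.singleLinearMap_apply]
    ext a b
    rw [← hent, h, kroneckerMap_apply, hsum]
    simp

/-! ### The composed map: link product, positivity and trace preservation. -/

/-- Closing the loop contracts row indices with row indices and column indices with column indices;
writing this as a matrix product is what introduces the transpose of `choi N` in the program. -/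
theorem choi_compose_apply [Fintype Ao] [DecidableEq Ao]
    (P : Matrix (Ai × Bi) (Ai × Bi) ℂ →ₗ[ℂ] Matrix (Ao × Bo) (Ao × Bo) ℂ)
    (N : Matrix Ao Ao ℂ →ₗ[ℂ] Matrix Bi Bi ℂ) (i j : Ai) (p q : Bo) :
    choi (compose P N) (i, p) (j, q) = ∑ x : Ao × Bi, ∑ y : Ao × Bi,
      choi N x y * choi P ((i, x.2), (x.1, p)) ((j, y.2), (y.1, q)) := by
  simp only [choi_apply, compose, LinearMap.coe_mk, AddHom.coe_mk, Matrix.of_apply,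
    ampliate_apply, Fintype.sum_prod_type, single_prod_eq_kronecker]
  simp only [← Finset.sum_product']
  refine Finset.sum_bij' (fun x _ => (x.2.2.1, x.1, x.2.2.2, x.2.1))
    (fun x _ => (x.2.1, x.2.2.2, x.1, x.2.2.1)) ?_ ?_ ?_ ?_ ?_ <;> simp [mul_comm]

/-- The link product is a contraction of the positive matrix `choi N ⊗ choi P`, so
`posSemidef_contract` applies. -/
theorem posSemidef_choi_compose [Fintype Ao] [DecidableEq Ao] [Fintype Bo]
    {P : Matrix (Ai × Bi) (Ai × Bi) ℂ →ₗ[ℂ] Matrix (Ao × Bo) (Ao × Bo) ℂ}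
    {N : Matrix Ao Ao ℂ →ₗ[ℂ] Matrix Bi Bi ℂ} (hP : (choi P).PosSemidef)
    (hN : (choi N).PosSemidef) : (choi (compose P N)).PosSemidef := by
  have h := posSemidef_contract (hN.kronecker hP)
    (fun (s : Ai × Bo) (x : Ao × Bi) => (x, ((s.1, x.2), (x.1, s.2))))
  convert h using 1
  ext ⟨i, p⟩ ⟨j, q⟩
  rw [choi_compose_apply]
  rfl

theorem choi_compose_eq_traceLeft [Fintype Ao] [DecidableEq Ao] [Fintype Bo] [DecidableEq Bo]
    (P : Matrix (Ai × Bi) (Ai × Bi) ℂ →ₗ[ℂ] Matrix (Ao × Bo) (Ao × Bo) ℂ)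
    (N : Matrix Ao Ao ℂ →ₗ[ℂ] Matrix Bi Bi ℂ) :
    choi (compose P N) = traceLeft (((choi N).transpose ⊗ₖ (1 : Matrix (Ai × Bo) (Ai × Bo) ℂ)) *
      (choi P).submatrix regroup regroup) := by
  ext ⟨i, p⟩ ⟨j, q⟩
  rw [choi_compose_apply, Finset.sum_comm]
  simp only [traceLeft, Matrix.of_apply, Matrix.mul_apply, kroneckerMap_apply, transpose_apply,
    submatrix_apply, Matrix.one_apply]
  refine Finset.sum_congr rfl fun x _ => ?_
  simp [Fintype.sum_prod_type, regroup]

/-- A loop through a general channel need not preserve trace. Without signalling from B to A,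
discarding `Bo` leaves an identity on `Bi`, so `N` enters only through the trace of its output and
drops out; the marginal of `P` remains. -/
theorem traceRight_choi_compose [Nonempty Bi] [Fintype Ao] [DecidableEq Ao] [Fintype Bo]
    {P : Matrix (Ai × Bi) (Ai × Bi) ℂ →ₗ[ℂ] Matrix (Ao × Bo) (Ao × Bo) ℂ}
    {N : Matrix Ao Ao ℂ →ₗ[ℂ] Matrix Bi Bi ℂ} (hN : IsTP N) (hP : IsTP P) (hBA : NoSignalBA P) :
    traceRight (choi (compose P N)) = 1 := by
  rw [noSignalBA_iff] at hBA
  rw [isTP_iff_traceRight_choi] at hN hP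
  ext i j
  have h1 : traceRight (choi (compose P N)) i j = ∑ x : Ao × Bi, ∑ y : Ao × Bi,
      choi N x y * traceBo (choi P) (x.2, i, x.1) (y.2, j, y.1) := by
    simp only [traceRight, Matrix.of_apply, choi_compose_apply, traceBo, Finset.mul_sum]
    rw [Finset.sum_comm]
    exact Finset.sum_congr rfl fun x _ => Finset.sum_comm
  have h2 : traceRight (choi (compose P N)) i j = ∑ a : Ao, ∑ b : Ao,
      traceRight (choi N) a b *
        ((Fintype.card Bi : ℂ)⁻¹ * traceLeft (traceBo (choi P)) (i, a) (j, b)) := by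
    rw [h1, hBA]
    simp only [kroneckerMap_apply, Matrix.smul_apply, Matrix.one_apply, Fintype.sum_prod_type,
      traceRight, Matrix.of_apply, Finset.sum_mul]
    refine Finset.sum_congr rfl fun a _ => ?_
    rw [Finset.sum_comm]
    refine Finset.sum_congr rfl fun b _ => ?_
    refine Finset.sum_congr rfl fun k _ => ?_
    simp [traceLeft, kroneckerMap_apply]
  rw [h2, hN]
  simp only [Matrix.one_apply, ite_mul, one_mul, zero_mul, Finset.sum_ite_eq, Finset.mem_univ,
    if_true, ← Finset.mul_sum]
  -- The remaining sum over `Bi` gives `|Bi|` on the diagonal, cancelling the normalization.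
  have h3 : ∑ a, traceLeft (traceBo (choi P)) (i, a) (j, a) =
      ∑ k, traceRight (choi P) (i, k) (j, k) := by
    simp only [traceLeft, traceBo, traceRight, Matrix.of_apply, Fintype.sum_prod_type]
    exact Finset.sum_comm
  rw [h3, hP]
  by_cases hij : i = j
  · simp [hij, Matrix.one_apply]
  · simp [hij]

theorem isNSCode_iff [Nonempty Ai] [Nonempty Bi] [Fintype Ao] [Fintype Bo]
    (P : Matrix (Ai × Bi) (Ai × Bi) ℂ →ₗ[ℂ] Matrix (Ao × Bo) (Ao × Bo) ℂ) :
    IsNSCode P ↔ (0 ≤ choi P ∧ traceRight (choi P) = 1) ∧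
      traceAo (choi P) = ((Fintype.card Ai : ℂ)⁻¹ • (1 : Matrix Ai Ai ℂ)) ⊗ₖ
        traceLeft (traceAo (choi P)) ∧
      traceBo (choi P) = ((Fintype.card Bi : ℂ)⁻¹ • (1 : Matrix Bi Bi ℂ)) ⊗ₖ
        traceLeft (traceBo (choi P)) := by
  rw [IsNSCode, IsChannel, noSignalAB_iff, noSignalBA_iff, isCP_iff_posSemidef_choi,
    isTP_iff_traceRight_choi, nonneg_iff_posSemidef]

theorem diamondNorm_nonneg {m n : Type*} [Fintype m] [DecidableEq m] [Fintype n] [DecidableEq n]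
    (F : Matrix m m ℂ →ₗ[ℂ] Matrix n n ℂ) : 0 ≤ diamondNorm F := by
  refine le_iSup_of_le 0 (le_iSup_of_le 0 (le_iSup_of_le ?_ ?_))
  · rw [traceNorm_of_posSemidef PosSemidef.zero]
    simp
  · exact_mod_cast traceNorm_nonneg _

/-! ### Equality of the simulation error and the program's value. -/

/-- The simulation error over no-signalling codes with a property of their Choi matrices is the
value of the semidefinite program restricted by that property. -/
theorem simError_eq_sInf [Nonempty Ai] [Nonempty Bi] [Fintype Ao] [DecidableEq Ao]
    [Fintype Bo] [DecidableEq Bo]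
    {N : Matrix Ao Ao ℂ →ₗ[ℂ] Matrix Bi Bi ℂ} (hN : IsChannel N)
    {M : Matrix Ai Ai ℂ →ₗ[ℂ] Matrix Bo Bo ℂ} (hM : IsChannel M)
    (C : Matrix ((Ai × Bi) × (Ao × Bo)) ((Ai × Bi) × (Ao × Bo)) ℂ → Prop) :
    simError {P | IsNSCode P ∧ C (choi P)} N M =
      sInf {x : EReal | ∃ (γ : ℝ) (Y JE : Matrix (Ai × Bo) (Ai × Bo) ℂ)
        (J : Matrix ((Ai × Bi) × (Ao × Bo)) ((Ai × Bi) × (Ao × Bo)) ℂ),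
        SDPFeasible (choi N) (choi M) γ Y JE J ∧ C J ∧ x = (γ : EReal)} := by
  have hzero : ∀ P : Matrix (Ai × Bi) (Ai × Bi) ℂ →ₗ[ℂ] Matrix (Ao × Bo) (Ao × Bo) ℂ,
      IsNSCode P → traceRight (choi (compose P N - M)) = 0 := by
    intro P hP
    rw [choi_sub, traceRight_sub, traceRight_choi_compose hN.2 hP.1.2 hP.2.2,
      (isTP_iff_traceRight_choi M).1 hM.2, sub_self]
  have hhalf : (0 : EReal) ≤ ((1 / 2 : ℝ) : EReal) := by
    rw [EReal.coe_nonneg]; norm_num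
  have hcancel : ∀ x : EReal, ((1 / 2 : ℝ) : EReal) * (((2 : ℝ) : EReal) * x) = x := by
    intro x
    rw [← mul_assoc, ← EReal.coe_mul]
    norm_num
  rw [simError]
  refine le_antisymm ?_ ?_
  -- A feasible `J` is the Choi matrix of a code, and weak duality bounds its error by `2γ`.
  · refine le_sInf ?_
    rintro _ ⟨γ, Y, JE, J, hF, hC, rfl⟩
    have hP : IsNSCode (ofChoi J) := by
      rw [isNSCode_iff, choi_ofChoi]
      exact ⟨⟨hF.cp, hF.tp⟩, hF.noSignalAB, hF.noSignalBA⟩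
    have hJE : choi (compose (ofChoi J) N) = JE := by
      rw [choi_compose_eq_traceLeft, choi_ofChoi, hF.effective]
    have h1 : diamondNorm (compose (ofChoi J) N - M) ≤ ((2 * γ : ℝ) : EReal) :=
      diamondNorm_le (hzero _ hP) hF.nonneg (by rw [choi_sub, hJE]; exact hF.sub_le) hF.trace_le
    rw [← hcancel (γ : EReal), ← EReal.coe_mul]
    refine mul_le_mul_of_nonneg_left (le_trans ?_ h1) hhalf
    exact iInf₂_le (ofChoi J) ⟨hP, by rwa [choi_ofChoi]⟩
  · rw [← hcancel (sInf _)]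
    refine mul_le_mul_of_nonneg_left (le_iInf₂ fun P hP => ?_) hhalf
    have hD := diamondNorm_nonneg (compose P N - M)
    induction hd : diamondNorm (compose P N - M) with
    | bot =>
      rw [hd] at hD
      exact absurd hD (by simp)
    | top => exact le_top
    | coe r =>
      rw [hd] at hD
      have hr : 0 ≤ r := by exact_mod_cast hD
      have hcp := (isCP_iff_posSemidef_choi P).1 hP.1.1.1
      have hher : (choi (compose P N - M)).IsHermitian := by
        rw [choi_sub]
        exact (posSemidef_choi_compose hcp ((isCP_iff_posSemidef_choi N).1 hN.1)).1.sub
          ((isCP_iff_posSemidef_choi M).1 hM.1).1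
      -- `exists_dominating` loses an arbitrarily small `ε`, so every real `z` above half the norm
      -- is shown feasible instead of half the norm itself.
      have hle : ∀ z : ℝ, ((r / 2 : ℝ) : EReal) < z → sInf {x : EReal | ∃ (γ : ℝ)
          (Y JE : Matrix (Ai × Bo) (Ai × Bo) ℂ)
          (J : Matrix ((Ai × Bi) × (Ao × Bo)) ((Ai × Bi) × (Ao × Bo)) ℂ),
          SDPFeasible (choi N) (choi M) γ Y JE J ∧ C J ∧ x = (γ : EReal)} ≤ z := by
        intro z hz
        rw [EReal.coe_lt_coe_iff] at hz
        obtain ⟨Y, hY, hYJ, hYt⟩ := exists_dominating hher (hzero P hP.1)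
          (d := r / 2) (by linarith) (by rw [hd, EReal.coe_le_coe_iff]; linarith)
          (sub_pos.2 hz)
        rw [add_sub_cancel] at hYt
        have hns := (isNSCode_iff P).1 hP.1
        exact sInf_le ⟨z, Y, choi (compose P N), choi P,
          { trace_le := hYt
            sub_le := by rwa [choi_sub] at hYJ
            nonneg := hY
            effective := choi_compose_eq_traceLeft P N
            cp := hns.1.1
            tp := hns.1.2
            noSignalAB := hns.2.1
            noSignalBA := hns.2.2 }, hP.2, rfl⟩
      have h2 := mul_le_mul_of_nonneg_left (EReal.le_of_forall_lt_iff_le.1 hle)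
        (by rw [EReal.coe_nonneg]; norm_num : (0 : EReal) ≤ ((2 : ℝ) : EReal))
      refine h2.trans_eq ?_
      rw [← EReal.coe_mul]
      congr 1
      ring

end Codes

end ChannelSim

theorem proposition1 {Ai Ao Bi Bo : Type*}
    [Fintype Ai] [DecidableEq Ai] [Nonempty Ai] [Fintype Ao] [DecidableEq Ao] [Nonempty Ao]
    [Fintype Bi] [DecidableEq Bi] [Nonempty Bi] [Fintype Bo] [DecidableEq Bo] [Nonempty Bo]
    (N : Matrix Ao Ao ℂ →ₗ[ℂ] Matrix Bi Bi ℂ) (hN : ChannelSim.IsChannel N)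
    (M : Matrix Ai Ai ℂ →ₗ[ℂ] Matrix Bo Bo ℂ) (hM : ChannelSim.IsChannel M) :
    ChannelSim.simError {P | ChannelSim.IsNSCode P} N M =
        sInf {x : EReal | ∃ (γ : ℝ) (Y JE : Matrix (Ai × Bo) (Ai × Bo) ℂ)
          (J : Matrix ((Ai × Bi) × (Ao × Bo)) ((Ai × Bi) × (Ao × Bo)) ℂ),
          ChannelSim.SDPFeasible (ChannelSim.choi N) (ChannelSim.choi M) γ Y JE J ∧
          x = (γ : EReal)} ∧
      ChannelSim.simError {P | ChannelSim.IsNSCode P ∧ ChannelSim.IsPPT P} N M =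
        sInf {x : EReal | ∃ (γ : ℝ) (Y JE : Matrix (Ai × Bo) (Ai × Bo) ℂ)
          (J : Matrix ((Ai × Bi) × (Ao × Bo)) ((Ai × Bi) × (Ao × Bo)) ℂ),
          ChannelSim.SDPFeasible (ChannelSim.choi N) (ChannelSim.choi M) γ Y JE J ∧
          0 ≤ ChannelSim.partialTransposeB J ∧ x = (γ : EReal)} := by
  constructor
  · simpa only [and_true, true_and] using
      ChannelSim.simError_eq_sInf hN hM (fun _ => True)
  · exact ChannelSim.simError_eq_sInf hN hM (fun J => 0 ≤ ChannelSim.partialTransposeB J)
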